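/- Let $E$ be a real Banach space that is uniformly convex and uniformly smooth, the latter meaning that the limit $\lim_{h\to 0}\frac{\|u+hv\|-\|u\|}{h}$ exists uniformly in the pair $(u,v)\in S(E)\times S(E)$, where $S(E)$ is the unit sphere of $E$. Let $j:E\to E^*$ be the normalized duality mapping of $E$, i.e. $j(x)$ is the unique functional with $j(x)(x)=\|x\|^2$ and $\|j(x)\|=\|x\|$, and for $x\in E$, $t>0$ put $$\beta^*_E(x,t):=\sup\left\{\frac{\|x+tv\|^2-\|x\|^2}{t}-2j(x)(v)\ :\ v\in S(E)\right\}$$ (with $\sup\emptyset:=0$ if $E=\{0\}$). Let $d\in[1,\infty)$ be such that $\beta^*_E(x,t)\le dt$ for all $x\in E$ and $t\in(0,\infty)$. Let $C\subseteq E$ be closed and convex, let $k\in(0,1)$, and let $T:C\to C$ be a $k$-strict pseudocontraction, i.e. $$j(x-y)\big((x-Tx)-(y-Ty)\big)\ \ge\ \frac{1-k}{2}\,\|(x-Tx)-(y-Ty)\|^2\qquad\text{for all }x,y\in C,$$ which has at least one fixed point. Let $x\in C$ and let $(t_n)_{n\in\mathbb N}\subseteq\left(0,\frac{1-k}{2d}\right)$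 satisfy $\sum_{n=0}^\infty t_n=\infty$. Then the Mann iteration defined by $x_0:=x$ and $x_{n+1}:=t_nTx_n+(1-t_n)x_n$ converges weakly to a fixed point of $T$. -/

import Mathlib

open Filter Topology

noncomputable section

/-- A normed space is uniformly smooth if the limit of `(‖u + h v‖ - ‖u‖) / h` as `h → 0`, `h ≠ 0`,
exists uniformly in the pair `(u, v)` of unit vectors. -/
def IsUniformlySmooth (E : Type*) [NormedAddCommGroup E] [NormedSpace ℝ E] : Prop :=
  ∃ L : E × E → ℝ, TendstoUniformlyOn
    (fun (h : ℝ) (p : E × E) => (‖p.1 + h • p.2‖ - ‖p.1‖) / h) L (𝓝[≠] 0)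
    (Metric.sphere (0 : E) 1 ×ˢ Metric.sphere (0 : E) 1)

/-- The normalized duality mapping `J : E → 2^{E^*}`. -/
def dualitySet {E : Type*} [NormedAddCommGroup E] [NormedSpace ℝ E] (x : E) :
    Set (StrongDual ℝ E) :=
  {f | f x = ‖x‖ ^ 2 ∧ ‖f‖ = ‖x‖}

theorem dualitySet_nonempty {E : Type*} [NormedAddCommGroup E] [NormedSpace ℝ E] (x : E) :
    (dualitySet x).Nonempty := by
  by_cases hx : x = 0
  · exact ⟨0, by simp [dualitySet, hx]⟩
  · obtain ⟨g, hg, hgx⟩ := exists_dual_vector ℝ x (norm_ne_zero_iff.mpr hx)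
    refine ⟨‖x‖ • g, ?_, ?_⟩
    · rw [ContinuousLinearMap.smul_apply, hgx]
      simp [sq]
    · rw [norm_smul, hg]
      simp

/-- The section `j : E → E^*` of the normalized duality mapping. When `E` is smooth, each `J x` is
a singleton, so that `j` is the unique section; it is used only for such spaces. -/
def dualityMap {E : Type*} [NormedAddCommGroup E] [NormedSpace ℝ E] (x : E) : StrongDual ℝ E :=
  (dualitySet_nonempty x).some

/-- The function `β*_E (x, t)`, the supremum over unit vectors `v` of
`(‖x + t v‖² - ‖x‖²) / t - 2 j(x)(v)`. For `t > 0` these numbers are bounded above by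
`4 ‖x‖ + t`, so this is a genuine supremum as soon as `E` is nontrivial. -/
def betaStar {E : Type*} [NormedAddCommGroup E] [NormedSpace ℝ E] (x : E) (t : ℝ) : ℝ :=
  sSup ((fun v : E => (‖x + t • v‖ ^ 2 - ‖x‖ ^ 2) / t - 2 * dualityMap x v) ''
    Metric.sphere (0 : E) 1)

/-- `T` is a `k`-strict pseudocontraction on `C`. -/
def IsStrictPseudocontractionOn {E : Type*} [NormedAddCommGroup E] [NormedSpace ℝ E]
    (k : ℝ) (T : E → E) (C : Set E) : Prop :=
  ∀ x ∈ C, ∀ y ∈ C,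
    (1 - k) / 2 * ‖(x - T x) - (y - T y)‖ ^ 2 ≤ dualityMap (x - y) ((x - T x) - (y - T y))

/-- The Mann iteration `x₀ = x`, `xₙ₊₁ = tₙ T xₙ + (1 - tₙ) xₙ`. -/
def mannIteration {E : Type*} [NormedAddCommGroup E] [NormedSpace ℝ E]
    (T : E → E) (t : ℕ → ℝ) (x : E) : ℕ → E
  | 0 => x
  | n + 1 => t n • T (mannIteration T t x n) + (1 - t n) • mannIteration T t x n

end

/-!
Weak convergence of the Mann iteration of a strict pseudocontraction.

Write `A = I - T`, `l = (1 - k) / 2` and `s = (1 - k) / (2 d)`. The bound on `β*` says that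
`‖x + w‖² ≤ ‖x‖² + 2 j(x)(w) + d ‖w‖²`. Applied to `(u - v) - t (A u - A v)` it shows that every
Mann step `I - t A` with `0 < t ≤ s` satisfies
`‖(u - t A u) - (v - t A v)‖² ≤ ‖u - v‖² - l t ‖A u - A v‖²`
(`mannStepsContractOn_of_strictPseudocontraction`). All else rests on this estimate, on uniform
convexity, and once more on the quadratic bound.

* Asymptotic regularity (`MannStepsContractOn.tendsto_norm_displacement`): `∑ tₙ ‖A xₙ‖²` is finite
  and `‖A xₙ‖` decreases, so `A xₙ → 0`.
* Demiclosedness (`MannStepsContractOn.exists_fixedPoint_mem_closure_convexHull`): a bounded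
  sequence with `A yₙ → 0` has a fixed point common to the closed convex hulls of its tails. The gain
  term makes segments between approximate fixed points consist of approximate fixed points.
* Uniqueness (`MannStepsContractOn.cauchySeq_dualityMap`): for fixed points `p`, `q` the numbers
  `j(p - q)(xₙ)` converge. If `p` and `q` both lie in the closed convex hulls of all tails of `(xₙ)`,
  then `j(p - q)` takes the limit value at both, so `‖p - q‖² = j(p - q)(p - q) = 0`.

Weak cluster points are replaced throughout by common points of closed convex tail hulls, which exist
by uniform convexity (`nonempty_iInter_of_antitone_convex`); no reflexivity theorem or weak
compactness is needed. The fixed point found for the whole sequence lies in the tail hulls of every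
subsequence, and this is weak convergence (`tendsto_toWeakSpace_of_forall_subseq`).
-/

/-! ### Uniform convexity -/

section UniformConvexity

variable {E : Type*} [NormedAddCommGroup E] [NormedSpace ℝ E] [UniformConvexSpace E]

/-- Uniform convexity at all radii `D ≤ R` at once: the same `δ` serves every such `D`. -/
theorem exists_forall_closedBall_norm_sub_lt {ε : ℝ} (hε : 0 < ε) (R : ℝ) :
    ∃ δ > 0, ∀ D ≤ R, ∀ a b : E, ‖a‖ ≤ D → ‖b‖ ≤ D → 2 * D - δ < ‖a + b‖ → ‖a - b‖ < ε := by
  have hR : (0 : ℝ) < |R| + 1 := by positivity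
  obtain ⟨δ, hδ, h⟩ := exists_forall_closed_ball_dist_add_le_two_sub E (div_pos hε hR)
  refine ⟨ε / 2 * δ, by positivity, fun D hD a b ha hb hab => ?_⟩
  by_contra! hlt
  have hsub : ‖a - b‖ ≤ 2 * D := (norm_sub_le a b).trans (by linarith)
  have hDε : ε / 2 ≤ D := by linarith
  have hD0 : 0 < D := by linarith
  have hDR : D ≤ |R| + 1 := by linarith [le_abs_self R]
  have key := @h (D⁻¹ • a) (by
      rw [norm_smul, norm_inv, Real.norm_of_nonneg hD0.le, inv_mul_le_one₀ hD0]; exact ha)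
    (D⁻¹ • b) (by
      rw [norm_smul, norm_inv, Real.norm_of_nonneg hD0.le, inv_mul_le_one₀ hD0]; exact hb)
    (by
      rw [← smul_sub, norm_smul, norm_inv, Real.norm_of_nonneg hD0.le, inv_mul_eq_div]
      gcongr)
  rw [← smul_add, norm_smul, norm_inv, Real.norm_of_nonneg hD0.le, inv_mul_le_iff₀ hD0] at key
  have : ε / 2 * δ ≤ D * δ := by gcongr
  linarith

/-- Uniform convexity for unequal weights `c` and `1 - c`. -/
theorem exists_forall_closedBall_norm_sub_lt_of_weight {ε : ℝ} (hε : 0 < ε) (R : ℝ) {c : ℝ}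
    (hc0 : 0 < c) (hc : c ≤ 1 / 2) :
    ∃ δ > 0, ∀ D ≤ R, ∀ a b : E, ‖a‖ ≤ D → ‖b‖ ≤ D →
      D - δ < ‖c • a + (1 - c) • b‖ → ‖a - b‖ < ε := by
  obtain ⟨δ, hδ, h⟩ := exists_forall_closedBall_norm_sub_lt (E := E) hε R
  refine ⟨c * δ, by positivity, fun D hD a b ha hb hab => h D hD a b ha hb ?_⟩
  have e : c • a + (1 - c) • b = c • (a + b) + (1 - 2 * c) • b := by module
  have h1 : ‖c • a + (1 - c) • b‖ ≤ c * ‖a + b‖ + (1 - 2 * c) * D := by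
    rw [e]
    refine (norm_add_le _ _).trans ?_
    rw [norm_smul, norm_smul, Real.norm_of_nonneg hc0.le, Real.norm_of_nonneg (by linarith)]
    gcongr
    linarith
  have h2 : c * (2 * D - δ) < c * ‖a + b‖ := by linarith
  exact lt_of_mul_lt_mul_left h2 hc0.le

/-- In a uniformly convex Banach space a decreasing sequence of nonempty bounded closed convex sets
has a common point: points of almost minimal norm form a Cauchy sequence. This replaces
reflexivity. -/
theorem nonempty_iInter_of_antitone_convex [CompleteSpace E] {K : ℕ → Set E} (hK : Antitone K)
    (hne : ∀ n, (K n).Nonempty) (hcl : ∀ n, IsClosed (K n)) (hcv : ∀ n, Convex ℝ (K n))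
    {R : ℝ} (hR : ∀ z ∈ K 0, ‖z‖ ≤ R) : (⋂ n, K n).Nonempty := by
  set r : ℕ → ℝ := fun n => Metric.infDist 0 (K n) with hr
  have hrle : ∀ n, ∀ z ∈ K n, r n ≤ ‖z‖ := fun n z hz => by
    simpa using Metric.infDist_le_dist_of_mem (x := (0 : E)) hz
  have hrmono : Monotone r := fun m n hmn =>
    Metric.infDist_le_infDist_of_subset (hK hmn) (hne n)
  have hrR : ∀ n, r n ≤ R := fun n => by
    obtain ⟨z, hz⟩ := hne n
    exact (hrle n z hz).trans (hR z (hK (Nat.zero_le n) hz))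
  have hbdd : BddAbove (Set.range r) := ⟨R, by rintro _ ⟨n, rfl⟩; exact hrR n⟩
  have hlim := tendsto_atTop_ciSup hrmono hbdd
  set ρ := ⨆ n, r n
  have hex : ∀ n : ℕ, ∃ z ∈ K n, ‖z‖ < r n + 1 / ((n : ℝ) + 1) := fun n => by
    obtain ⟨z, hz, hlt⟩ := (Metric.infDist_lt_iff (x := (0 : E)) (hne n)).1
      (lt_add_of_pos_right (r n) (Nat.one_div_pos_of_nat (α := ℝ) (n := n)))
    exact ⟨z, hz, by simpa using hlt⟩
  choose y hyK hy using hex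
  have hcauchy : CauchySeq y := by
    refine Metric.cauchySeq_iff'.2 fun ε hε => ?_
    obtain ⟨δ, hδ, h⟩ := exists_forall_closedBall_norm_sub_lt (E := E) hε (R + 1)
    set η := min (δ / 6) 1
    have hη : 0 < η := by positivity
    have ev1 : ∀ᶠ n in atTop, ρ - η < r n := hlim.eventually_const_lt (by linarith)
    have ev2 : ∀ᶠ n : ℕ in atTop, 1 / ((n : ℝ) + 1) < η :=
      tendsto_one_div_add_atTop_nhds_zero_nat.eventually_lt_const hη
    obtain ⟨N, hN⟩ := eventually_atTop.1 (ev1.and ev2)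
    refine ⟨N, fun n hn => ?_⟩
    have hρ : ρ ≤ R := ciSup_le hrR
    have hle : ∀ m, r m ≤ ρ := le_ciSup hbdd
    rw [dist_eq_norm]
    have hη1 : η ≤ δ / 6 := min_le_left _ _
    have hη2 : η ≤ 1 := min_le_right _ _
    refine h (ρ + η) (by linarith) (y n) (y N)
      (by linarith [hy n, (hN n hn).2, hle n]) (by linarith [hy N, (hN N le_rfl).2, hle N]) ?_
    have hmid := hrle N _ (hcv N (hK hn (hyK n)) (hyK N) (a := 1 / 2) (b := 1 / 2)
      (by norm_num) (by norm_num) (by norm_num))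
    rw [← smul_add, norm_smul, Real.norm_of_nonneg (by norm_num)] at hmid
    linarith [(hN N le_rfl).1]
  obtain ⟨z, hz⟩ := cauchySeq_tendsto_of_complete hcauchy
  exact ⟨z, Set.mem_iInter.2 fun n => (hcl n).mem_of_tendsto hz
    (eventually_atTop.2 ⟨n, fun m hm => hK hm (hyK m)⟩)⟩

end UniformConvexity

/-! ### The duality mapping and the smoothness inequality -/

section Duality

variable {E : Type*} [NormedAddCommGroup E] [NormedSpace ℝ E]

theorem dualityMap_apply_self (x : E) : dualityMap x x = ‖x‖ ^ 2 :=
  (dualitySet_nonempty x).some_mem.1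

theorem norm_dualityMap (x : E) : ‖dualityMap x‖ = ‖x‖ :=
  (dualitySet_nonempty x).some_mem.2

/-- `2 j(x)` is a subgradient of `‖·‖²` at `x`. -/
theorem norm_sq_add_two_mul_dualityMap_le (x w : E) :
    ‖x‖ ^ 2 + 2 * dualityMap x w ≤ ‖x + w‖ ^ 2 := by
  have h1 : dualityMap x (x + w) ≤ ‖x‖ * ‖x + w‖ := by
    rw [← norm_dualityMap x]
    exact (le_abs_self _).trans ((dualityMap x).le_opNorm _)
  rw [map_add, dualityMap_apply_self] at h1
  nlinarith [sq_nonneg (‖x‖ - ‖x + w‖)]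

theorem le_betaStar (x : E) {t : ℝ} (ht : 0 < t) {v : E} (hv : ‖v‖ = 1) :
    (‖x + t • v‖ ^ 2 - ‖x‖ ^ 2) / t - 2 * dualityMap x v ≤ betaStar x t := by
  refine le_csSup ⟨4 * ‖x‖ + t, ?_⟩ ⟨v, by simpa using hv, rfl⟩
  rintro _ ⟨w, hw, rfl⟩
  have hw1 : ‖w‖ = 1 := by simpa using hw
  have h1 : ‖x + t • w‖ ≤ ‖x‖ + t := by
    refine (norm_add_le _ _).trans_eq ?_
    rw [norm_smul, hw1, Real.norm_of_nonneg ht.le, mul_one]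
  have h2 : (‖x + t • w‖ ^ 2 - ‖x‖ ^ 2) / t ≤ 2 * ‖x‖ + t := by
    rw [div_le_iff₀ ht]
    nlinarith [norm_nonneg (x + t • w), norm_nonneg x]
  have h3 : -‖x‖ ≤ dualityMap x w := by
    have := (dualityMap x).le_opNorm w
    rw [norm_dualityMap, hw1, mul_one] at this
    exact (abs_le.1 this).1
  dsimp only
  linarith

/-- The bound `β*(x, t) ≤ d t` as a quadratic upper estimate of `‖·‖²`. -/
theorem norm_add_sq_le_of_betaStar_le {d : ℝ}
    (hβ : ∀ (x : E) (t : ℝ), 0 < t → betaStar x t ≤ d * t) (x w : E) :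
    ‖x + w‖ ^ 2 ≤ ‖x‖ ^ 2 + 2 * dualityMap x w + d * ‖w‖ ^ 2 := by
  rcases eq_or_ne w 0 with rfl | hw
  · simp
  have ht : 0 < ‖w‖ := norm_pos_iff.2 hw
  have h := (le_betaStar x ht (norm_smul_inv_norm (𝕜 := ℝ) hw)).trans (hβ x _ ht)
  simp only [RCLike.ofReal_real_eq_id, id_eq, map_smul, smul_eq_mul] at h
  rw [smul_inv_smul₀ ht.ne', sub_le_iff_le_add, div_le_iff₀ ht] at h
  have e : (d * ‖w‖ + 2 * (‖w‖⁻¹ * dualityMap x w)) * ‖w‖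
      = d * ‖w‖ ^ 2 + 2 * dualityMap x w := by
    field_simp
  linarith

end Duality

/-! ### Contraction estimate for the Mann steps -/

section MannStep

variable {E : Type*} [NormedAddCommGroup E] [NormedSpace ℝ E]

/-- One step `t T y + (1 - t) y` of the Mann iteration. -/
def mannStep (T : E → E) (t : ℝ) (y : E) : E := t • T y + (1 - t) • y

/-- All Mann steps of size at most `s` are nonexpansive on `C`, with a gain controlled by the
displacements: `‖S u - S v‖² ≤ ‖u - v‖² - l t ‖(u - T u) - (v - T v)‖²` for the step `S` of
size `t ∈ (0, s]`. -/
def MannStepsContractOn (T : E → E) (C : Set E) (l s : ℝ) : Prop :=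
  ∀ u ∈ C, ∀ v ∈ C, ∀ t, 0 < t → t ≤ s →
    ‖mannStep T t u - mannStep T t v‖ ^ 2 ≤
      ‖u - v‖ ^ 2 - l * t * ‖(u - T u) - (v - T v)‖ ^ 2

theorem mannStep_eq_sub (T : E → E) (t : ℝ) (y : E) :
    mannStep T t y = y - t • (y - T y) := by
  unfold mannStep; module

theorem mannStep_of_fixed {T : E → E} {p : E} (hp : T p = p) (t : ℝ) : mannStep T t p = p := by
  simp [mannStep_eq_sub, hp]

theorem mannIteration_succ (T : E → E) (t : ℕ → ℝ) (x : E) (n : ℕ) :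
    mannIteration T t x (n + 1) = mannStep T (t n) (mannIteration T t x n) := rfl

/-- The orbit from time `n` on is a Mann orbit for the shifted step sizes. -/
theorem mannIteration_add (T : E → E) (t : ℕ → ℝ) (x : E) (n m : ℕ) :
    mannIteration T t x (n + m) =
      mannIteration T (fun i => t (n + i)) (mannIteration T t x n) m := by
  induction m with
  | zero => rfl
  | succ m ih => rw [← add_assoc, mannIteration_succ, mannIteration_succ, ih]

theorem mannIteration_of_fixed {T : E → E} {p : E} (hp : T p = p) (t : ℕ → ℝ) (n : ℕ) :
    mannIteration T t p n = p := by
  induction n with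
  | zero => rfl
  | succ n ih => rw [mannIteration_succ, ih, mannStep_of_fixed hp]

theorem mannIteration_mem {T : E → E} {C : Set E} (hC : Convex ℝ C) (hTC : Set.MapsTo T C C)
    {t : ℕ → ℝ} (ht : ∀ n, t n ∈ Set.Icc (0 : ℝ) 1) {x : E} (hx : x ∈ C) (n : ℕ) :
    mannIteration T t x n ∈ C := by
  induction n with
  | zero => exact hx
  | succ n ih => exact hC (hTC ih) ih (ht n).1 (by linarith [(ht n).2]) (by ring)

/-- For a strict pseudocontraction `T` the contraction estimate follows by expanding
`‖(u - v) - t ((u - T u) - (v - T v))‖²` with the quadratic upper estimate of `‖·‖²`; the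
constraint `t ≤ (1 - k) / (2 d)` keeps half of the linear term. -/
theorem mannStepsContractOn_of_strictPseudocontraction {d k : ℝ} (hd : 0 < d)
    (hsm : ∀ x w : E, ‖x + w‖ ^ 2 ≤ ‖x‖ ^ 2 + 2 * dualityMap x w + d * ‖w‖ ^ 2)
    {T : E → E} {C : Set E} (hT : IsStrictPseudocontractionOn k T C) :
    MannStepsContractOn T C ((1 - k) / 2) ((1 - k) / (2 * d)) := by
  intro u hu v hv t ht0 hts
  rw [mannStep_eq_sub, mannStep_eq_sub]
  set w := (u - T u) - (v - T v) with hw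
  have e : u - t • (u - T u) - (v - t • (v - T v)) = (u - v) + (-t) • w := by
    rw [hw]; module
  rw [e]
  have h1 := hsm (u - v) ((-t) • w)
  have h2 := hT u hu v hv
  rw [← hw] at h2
  rw [norm_smul, mul_pow, Real.norm_eq_abs, sq_abs, map_smul, smul_eq_mul] at h1
  rw [le_div_iff₀ (by positivity)] at hts
  have h3 : t * ((1 - k) / 2 * ‖w‖ ^ 2) ≤ t * dualityMap (u - v) w := by gcongr
  have h4 : t * ‖w‖ ^ 2 * (t * (2 * d)) ≤ t * ‖w‖ ^ 2 * (1 - k) := by gcongr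
  nlinarith

variable {T : E → E} {C : Set E} {l s : ℝ}

theorem MannStepsContractOn.norm_mannStep_sub_le (h : MannStepsContractOn T C l s)
    (hl : 0 ≤ l) {t : ℝ} (ht0 : 0 < t) (hts : t ≤ s) {u v : E} (hu : u ∈ C) (hv : v ∈ C) :
    ‖mannStep T t u - mannStep T t v‖ ≤ ‖u - v‖ := by
  refine le_of_sq_le_sq ?_ (norm_nonneg _)
  have : 0 ≤ l * t * ‖(u - T u) - (v - T v)‖ ^ 2 := by positivity
  linarith [h u hu v hv t ht0 hts]

theorem MannStepsContractOn.norm_mannIteration_sub_le (h : MannStepsContractOn T C l s)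
    (hl : 0 ≤ l) (hC : Convex ℝ C) (hTC : Set.MapsTo T C C) (hs1 : s ≤ 1) {t : ℕ → ℝ}
    (ht : ∀ n, t n ∈ Set.Ioo 0 s) {u v : E} (hu : u ∈ C) (hv : v ∈ C) (n : ℕ) :
    ‖mannIteration T t u n - mannIteration T t v n‖ ≤ ‖u - v‖ := by
  have ht' : ∀ n, t n ∈ Set.Icc (0 : ℝ) 1 := fun n => ⟨(ht n).1.le, (ht n).2.le.trans hs1⟩
  induction n with
  | zero => exact le_rfl
  | succ n ih =>
    exact (h.norm_mannStep_sub_le hl (ht n).1 (ht n).2.le (mannIteration_mem hC hTC ht' hu n)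
      (mannIteration_mem hC hTC ht' hv n)).trans ih

theorem MannStepsContractOn.antitone_norm_sub (h : MannStepsContractOn T C l s)
    (hl : 0 ≤ l) (hC : Convex ℝ C) (hTC : Set.MapsTo T C C) (hs1 : s ≤ 1) {t : ℕ → ℝ}
    (ht : ∀ n, t n ∈ Set.Ioo 0 s) {x p : E} (hx : x ∈ C) (hp : p ∈ C) (hpT : T p = p) :
    Antitone fun n => ‖mannIteration T t x n - p‖ := by
  have ht' : ∀ n, t n ∈ Set.Icc (0 : ℝ) 1 := fun n => ⟨(ht n).1.le, (ht n).2.le.trans hs1⟩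
  refine antitone_nat_of_succ_le fun n => ?_
  have := h.norm_mannStep_sub_le hl (ht n).1 (ht n).2.le (mannIteration_mem hC hTC ht' hx n) hp
  rwa [mannStep_of_fixed hpT] at this

/-- The displacement `y - T y` is Lipschitz on `C`. -/
theorem MannStepsContractOn.norm_displacement_sub_le (h : MannStepsContractOn T C l s)
    (hl : 0 < l) (hs : 0 < s) {u v : E} (hu : u ∈ C) (hv : v ∈ C) :
    Real.sqrt (l * s) * ‖(u - T u) - (v - T v)‖ ≤ ‖u - v‖ := by
  refine le_of_sq_le_sq ?_ (norm_nonneg _)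
  rw [mul_pow, Real.sq_sqrt (by positivity)]
  linarith [h u hu v hv s hs le_rfl, sq_nonneg ‖mannStep T s u - mannStep T s v‖]

/-- The displacement norms decrease along a Mann orbit, because each step is also a convex
combination of the identity and the nonexpansive step of maximal size `s`. -/
theorem MannStepsContractOn.norm_displacement_mannStep_le (h : MannStepsContractOn T C l s)
    (hl : 0 < l) (hC : Convex ℝ C) (hTC : Set.MapsTo T C C) (hs : 0 < s) (hs1 : s ≤ 1)
    {t : ℝ} (ht : t ∈ Set.Ioo 0 s) {y : E} (hy : y ∈ C) :
    ‖mannStep T t y - T (mannStep T t y)‖ ≤ ‖y - T y‖ := by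
  have hyC : mannStep T t y ∈ C :=
    hC (hTC hy) hy ht.1.le (by linarith [ht.2]) (by ring)
  have h1 := h.norm_mannStep_sub_le hl.le hs le_rfl hy hyC
  set z := mannStep T t y with hz
  have hzy : y - z = t • (y - T y) := by rw [hz, mannStep_eq_sub]; module
  have e : s • (z - T z) = (s - t) • (y - T y) + (mannStep T s y - mannStep T s z) := by
    rw [mannStep_eq_sub, mannStep_eq_sub]
    have : z = y - t • (y - T y) := by rw [← hzy]; module
    generalize T z = Tz
    rw [this]
    module
  have h2 : s * ‖z - T z‖ ≤ (s - t) * ‖y - T y‖ + t * ‖y - T y‖ := by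
    rw [← Real.norm_of_nonneg hs.le, ← norm_smul, e]
    refine (norm_add_le _ _).trans ?_
    rw [norm_smul, Real.norm_of_nonneg (sub_nonneg.2 ht.2.le), Real.norm_of_nonneg hs.le]
    rw [hzy, norm_smul, Real.norm_of_nonneg ht.1.le] at h1
    gcongr
  exact le_of_mul_le_mul_left (by linarith) hs

/-- Asymptotic regularity: since `∑ tₙ ‖xₙ - T xₙ‖²` converges, `∑ tₙ` diverges and the norms
`‖xₙ - T xₙ‖` decrease, they tend to `0`. -/
theorem MannStepsContractOn.tendsto_norm_displacement (h : MannStepsContractOn T C l s)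
    (hl : 0 < l) (hC : Convex ℝ C) (hTC : Set.MapsTo T C C) (hs : 0 < s) (hs1 : s ≤ 1)
    {t : ℕ → ℝ} (ht : ∀ n, t n ∈ Set.Ioo 0 s)
    (htsum : Tendsto (fun N : ℕ => ∑ n ∈ Finset.range N, t n) atTop atTop)
    {x p : E} (hx : x ∈ C) (hp : p ∈ C) (hpT : T p = p) :
    Tendsto (fun n => ‖mannIteration T t x n - T (mannIteration T t x n)‖) atTop (𝓝 0) := by
  have ht' : ∀ n, t n ∈ Set.Icc (0 : ℝ) 1 := fun n => ⟨(ht n).1.le, (ht n).2.le.trans hs1⟩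
  have hmem := mannIteration_mem hC hTC ht' hx
  set y := mannIteration T t x with hy
  have hanti : Antitone fun n => ‖y n - T (y n)‖ := antitone_nat_of_succ_le fun n =>
    h.norm_displacement_mannStep_le hl hC hTC hs hs1 (ht n) (hmem n)
  have hsum : ∀ N, l * ∑ n ∈ Finset.range N, t n * ‖y n - T (y n)‖ ^ 2 ≤
      ‖x - p‖ ^ 2 - ‖y N - p‖ ^ 2 := by
    intro N
    induction N with
    | zero => simp [hy, mannIteration]
    | succ N ih =>
      have h1 := h (y N) (hmem N) p hp (t N) (ht N).1 (ht N).2.le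
      rw [mannStep_of_fixed hpT, hpT, sub_self, sub_zero] at h1
      have h2 : y (N + 1) = mannStep T (t N) (y N) := rfl
      rw [Finset.sum_range_succ, mul_add, h2]
      linarith
  have hbound : ∀ N, ‖y N - T (y N)‖ ^ 2 * (l * ∑ n ∈ Finset.range N, t n) ≤ ‖x - p‖ ^ 2 := by
    intro N
    have h1 : (∑ n ∈ Finset.range N, t n) * ‖y N - T (y N)‖ ^ 2 ≤
        ∑ n ∈ Finset.range N, t n * ‖y n - T (y n)‖ ^ 2 := by
      rw [Finset.sum_mul]
      refine Finset.sum_le_sum fun n hn => ?_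
      have := hanti (Finset.mem_range.1 hn).le
      have := (ht n).1.le
      dsimp only at *
      gcongr
    have h2 := mul_le_mul_of_nonneg_left h1 hl.le
    linarith [hsum N, sq_nonneg ‖y N - p‖]
  have hdiv : Tendsto (fun N => l * ∑ n ∈ Finset.range N, t n) atTop atTop :=
    htsum.const_mul_atTop hl
  have hsq : Tendsto (fun n => ‖y n - T (y n)‖ ^ 2) atTop (𝓝 0) := by
    refine squeeze_zero' (Eventually.of_forall fun n => sq_nonneg _) ?_
      (hdiv.const_div_atTop (‖x - p‖ ^ 2))
    filter_upwards [hdiv.eventually_gt_atTop 0] with N hN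
    rw [le_div_iff₀ hN]
    exact hbound N
  have := hsq.sqrt
  simpa [Real.sqrt_sq] using this

end MannStep

/-! ### Approximate fixed points and demiclosedness -/

section ApproximateFixedPoints

variable {E : Type*} [NormedAddCommGroup E] [NormedSpace ℝ E] {T : E → E} {C : Set E} {l s : ℝ}

/-- Points on the segment between two approximate fixed points are approximate fixed points. If
`z ∈ [u, v]` had a large displacement, then the step of size `s` would bring `z` strictly closer to
both `u` and `v` than `‖z - u‖` and `‖z - v‖`, against `‖u - v‖ = ‖z - u‖ + ‖z - v‖`. -/
theorem MannStepsContractOn.exists_forall_segment_displacement_le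
    (h : MannStepsContractOn T C l s) (hl : 0 < l) (hC : Convex ℝ C) (hs : 0 < s)
    {R : ℝ} (hR : 0 < R) {ε : ℝ} (hε : 0 < ε) :
    ∃ δ > 0, δ ≤ ε / 2 ∧ ∀ u ∈ C, ∀ v ∈ C, ‖u - v‖ ≤ R → ‖u - T u‖ ≤ δ → ‖v - T v‖ ≤ δ →
      ∀ z ∈ segment ℝ u v, ‖z - T z‖ ≤ ε := by
  refine ⟨min (ε / 2) (l * ε ^ 2 / (8 * R)), by positivity, min_le_left _ _, ?_⟩
  intro u hu v hv huv hTu hTv z hz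
  set δ := min (ε / 2) (l * ε ^ 2 / (8 * R)) with hδ
  have hδ1 : δ ≤ ε / 2 := min_le_left _ _
  have hδ2 : δ * (8 * R) ≤ l * ε ^ 2 := by
    rw [← le_div_iff₀ (by positivity)]; exact min_le_right _ _
  by_contra! hlt
  have hzC : z ∈ C := hC.segment_subset hu hv hz
  -- the loss of distance to an endpoint `w`
  have key : ∀ w ∈ C, ‖w - T w‖ ≤ δ → ‖z - w‖ ≤ R →
      ‖mannStep T s z - w‖ < ‖z - w‖ := by
    intro w hw hTw hzw
    have h1 := h z hzC w hw s hs le_rfl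
    have h2 : ε / 2 < ‖(z - T z) - (w - T w)‖ := by
      linarith [norm_sub_norm_le (z - T z) (w - T w)]
    have h3 : ‖mannStep T s z - w‖ ≤ ‖mannStep T s z - mannStep T s w‖ + s * δ := by
      have e : mannStep T s z - w
          = (mannStep T s z - mannStep T s w) + (-s) • (w - T w) := by
        rw [mannStep_eq_sub T s w]; module
      rw [e]
      refine (norm_add_le _ _).trans ?_
      rw [norm_smul, norm_neg, Real.norm_of_nonneg hs.le]
      gcongr
    have h4 : (ε / 2) ^ 2 < ‖(z - T z) - (w - T w)‖ ^ 2 := by gcongr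
    have h5 : l * s * (ε / 2) ^ 2 < l * s * ‖(z - T z) - (w - T w)‖ ^ 2 := by gcongr
    have h6 : s * (δ * (8 * R)) ≤ s * (l * ε ^ 2) := by gcongr
    set X := ‖mannStep T s z - mannStep T s w‖
    set a := ‖z - w‖
    have hX : 0 ≤ X := norm_nonneg _
    have ha : 0 ≤ a := norm_nonneg _
    -- `(a - X) (a + X) > 2 R s δ` and `a + X ≤ 2 R`
    by_contra! hge
    have h7 : a - X ≤ s * δ := by linarith
    have h8 : X < a := by
      refine lt_of_pow_lt_pow_left₀ 2 ha ?_
      have : 0 < l * s * (ε / 2) ^ 2 := by positivity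
      linarith
    have h9 : (a - X) * (a + X) ≤ (s * δ) * (2 * R) := by
      apply mul_le_mul h7 (by linarith) (by linarith) (by linarith)
    nlinarith
  have hsum : dist u z + dist z v = dist u v := dist_add_dist_of_mem_segment hz
  rw [dist_eq_norm, dist_eq_norm, dist_eq_norm, norm_sub_rev u z] at hsum
  have k1 := key u hu hTu (by linarith [norm_nonneg (z - v)])
  have k2 := key v hv hTv (by linarith [norm_nonneg (z - u)])
  have htri : ‖u - v‖ ≤ ‖mannStep T s z - u‖ + ‖mannStep T s z - v‖ := by
    rw [norm_sub_rev _ u]; exact norm_sub_le_norm_sub_add_norm_sub _ _ _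
  linarith

/-- Demiclosedness in a form that avoids the weak topology: a bounded sequence of approximate fixed
points has a fixed point in the closed convex hulls of all its tails. Along a subsequence whose
displacements decrease fast enough, peeling off one point at a time shows that all points of the
tail hulls are approximate fixed points, and the tail hulls have a common point. -/
theorem MannStepsContractOn.exists_fixedPoint_mem_closure_convexHull [CompleteSpace E]
    [UniformConvexSpace E] (h : MannStepsContractOn T C l s) (hl : 0 < l) (hC : Convex ℝ C)
    (hCc : IsClosed C) (hs : 0 < s) {y : ℕ → E} (hy : ∀ n, y n ∈ C) {M : ℝ}
    (hM : ∀ n, ‖y n‖ ≤ M) (hlim : Tendsto (fun n => ‖y n - T (y n)‖) atTop (𝓝 0)) :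
    ∃ q ∈ C, T q = q ∧ ∀ n, q ∈ closure (convexHull ℝ (y '' Set.Ici n)) := by
  have hM0 : 0 ≤ M := (norm_nonneg _).trans (hM 0)
  have hex := fun ε (hε : 0 < ε) =>
    h.exists_forall_segment_displacement_le hl hC hs (R := 2 * M + 1) (by positivity) hε
  choose! δ hδ0 hδ hseg using hex
  -- tolerances with `e (i + 1) = δ (e i)`
  set e : ℕ → ℝ := fun i => δ^[i] 1 with he
  have he_succ : ∀ i, e (i + 1) = δ (e i) := fun i => Function.iterate_succ_apply' δ i 1
  have he0 : ∀ i, 0 < e i := by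
    intro i
    induction i with
    | zero => simp [he]
    | succ i ih => rw [he_succ]; exact hδ0 _ ih
  have he_le : ∀ i, e (i + 1) ≤ e i / 2 := fun i => by rw [he_succ]; exact hδ _ (he0 i)
  have hepow : ∀ i, e i ≤ (1 / 2) ^ i := by
    intro i
    induction i with
    | zero => simp [he]
    | succ i ih => rw [pow_succ]; linarith [he_le i]
  obtain ⟨φ, hφ, hφe⟩ := extraction_forall_of_eventually
    (P := fun i n => ‖y n - T (y n)‖ < e (i + 1))
    (fun i => hlim.eventually_lt_const (he0 (i + 1)))
  set B : Set E := C ∩ Metric.closedBall 0 M with hB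
  have hBcv : Convex ℝ B := hC.inter (convex_closedBall 0 M)
  have hBcl : IsClosed B := hCc.inter Metric.isClosed_closedBall
  have hyB : ∀ n, y n ∈ B := fun n => ⟨hy n, by simpa using hM n⟩
  have hfin : ∀ N i, ∀ z ∈ convexHull ℝ ((y ∘ φ) '' Set.Icc i (i + N)),
      ‖z - T z‖ ≤ e i := by
    intro N
    induction N with
    | zero =>
      intro i z hz
      have : z = y (φ i) := by simpa using hz
      rw [this]
      linarith [hφe i, he_le i, he0 i]
    | succ N ih =>
      intro i z hz
      have hI : Set.Icc i (i + (N + 1)) = insert i (Set.Icc (i + 1) (i + 1 + N)) := by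
        ext j; simp only [Set.mem_Icc, Set.mem_insert_iff]; omega
      rw [hI, Set.image_insert_eq, convexHull_insert
        ((Set.nonempty_Icc.2 (by omega)).image _), mem_convexJoin] at hz
      obtain ⟨u, hu, v, hv, hz⟩ := hz
      rw [Set.mem_singleton_iff] at hu
      subst hu
      have hvB : v ∈ B := convexHull_min (by rintro _ ⟨j, -, rfl⟩; exact hyB _) hBcv hv
      have hvM : ‖v‖ ≤ M := by simpa using hvB.2
      refine hseg (e i) (he0 i) _ (hy (φ i)) v hvB.1 ?_ ?_ ?_ z hz
      · refine (norm_sub_le _ _).trans ?_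
        linarith [hM (φ i)]
      · rw [← he_succ]; exact (hφe i).le
      · rw [← he_succ]; exact ih (i + 1) v hv
  have htail : ∀ i, ∀ z ∈ convexHull ℝ ((y ∘ φ) '' Set.Ici i), ‖z - T z‖ ≤ e i := by
    intro i z hz
    have hdir : Directed (· ⊆ ·) fun N => convexHull ℝ ((y ∘ φ) '' Set.Icc i (i + N)) :=
      directed_of_isDirected_le fun m n hmn => convexHull_mono
        (Set.image_mono (Set.Icc_subset_Icc_right (by omega)))
    have hsub : convexHull ℝ ((y ∘ φ) '' Set.Ici i) ⊆
        ⋃ N, convexHull ℝ ((y ∘ φ) '' Set.Icc i (i + N)) := by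
      refine convexHull_min ?_ (hdir.convex_iUnion fun N => convex_convexHull ℝ _)
      rintro _ ⟨j, hj, rfl⟩
      exact Set.mem_iUnion.2 ⟨j, subset_convexHull ℝ _ ⟨j, ⟨hj, by omega⟩, rfl⟩⟩
    obtain ⟨N, hN⟩ := Set.mem_iUnion.1 (hsub hz)
    exact hfin N i z hN
  have hKB : ∀ i, closure (convexHull ℝ ((y ∘ φ) '' Set.Ici i)) ⊆ B := fun i =>
    closure_minimal (convexHull_min (by rintro _ ⟨j, -, rfl⟩; exact hyB _) hBcv) hBcl
  obtain ⟨q, hq⟩ := nonempty_iInter_of_antitone_convex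
    (K := fun i => closure (convexHull ℝ ((y ∘ φ) '' Set.Ici i)))
    (fun m n hmn => closure_mono (convexHull_mono (Set.image_mono (Set.Ici_subset_Ici.2 hmn))))
    (fun n => ((Set.nonempty_Ici.image _).convexHull).closure)
    (fun n => isClosed_closure) (fun n => (convex_convexHull ℝ _).closure)
    (R := M) (fun z hz => by simpa using (hKB 0 hz).2)
  rw [Set.mem_iInter] at hq
  have hqC : q ∈ C := (hKB 0 (hq 0)).1
  have hqe : ∀ i, ‖q - T q‖ ≤ e i := by
    intro i
    refine le_of_forall_pos_le_add fun η hη => ?_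
    obtain ⟨z, hz, hqz⟩ := Metric.mem_closure_iff.1 (hq i) (Real.sqrt (l * s) * η)
      (by positivity)
    have hzC : z ∈ C := (hKB i (subset_closure hz)).1
    have h1 := h.norm_displacement_sub_le hl hs hqC hzC
    rw [dist_eq_norm] at hqz
    have h2 : ‖(q - T q) - (z - T z)‖ < η :=
      lt_of_mul_lt_mul_left (h1.trans_lt hqz) (Real.sqrt_nonneg _)
    linarith [norm_sub_norm_le (q - T q) (z - T z), htail i z hz]
  refine ⟨q, hqC, ?_, fun n => ?_⟩
  · have hpow : Tendsto (fun i : ℕ => ((1 : ℝ) / 2) ^ i) atTop (𝓝 0) :=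
      tendsto_pow_atTop_nhds_zero_of_lt_one (by norm_num) (by norm_num)
    have h0 : ‖q - T q‖ ≤ 0 := ge_of_tendsto' hpow fun i => (hqe i).trans (hepow i)
    exact (sub_eq_zero.1 (norm_le_zero_iff.1 h0)).symm
  · refine closure_mono (convexHull_mono ?_) (hq n)
    rintro _ ⟨j, hj, rfl⟩
    exact ⟨φ j, le_trans hj (hφ.id_le j), rfl⟩

end ApproximateFixedPoints

/-! ### Convergence of the duality pairings along the orbit -/

section Pairings

theorem cauchySeq_of_eventually_le_add {a : ℕ → ℝ} (h0 : ∀ n, 0 ≤ a n)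
    (h : ∀ ε > 0, ∃ N, ∀ n ≥ N, ∀ m ≥ n, a m ≤ a n + ε) : CauchySeq a := by
  refine Metric.cauchySeq_iff'.2 fun ε hε => ?_
  obtain ⟨N, hN⟩ := h (ε / 3) (by positivity)
  set S := a '' Set.Ici N
  have hS : S.Nonempty := Set.nonempty_Ici.image _
  have hSb : BddBelow S := ⟨0, by rintro _ ⟨n, -, rfl⟩; exact h0 n⟩
  obtain ⟨_, ⟨n, hn, rfl⟩, hlt⟩ := exists_lt_of_csInf_lt hS
    (lt_add_of_pos_right (sInf S) (by positivity : 0 < ε / 3))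
  have hb : ∀ m ≥ n, a m ≤ sInf S + 2 * (ε / 3) ∧ sInf S ≤ a m := fun m hm =>
    ⟨by linarith [hN n hn m hm], csInf_le hSb ⟨m, le_trans hn hm, rfl⟩⟩
  refine ⟨n, fun m hm => ?_⟩
  rw [Real.dist_eq, abs_lt]
  constructor <;> linarith [hb m hm, hb n le_rfl]

variable {E : Type*} [NormedAddCommGroup E] [NormedSpace ℝ E] {T : E → E} {C : Set E} {l s : ℝ}

/-- For fixed points `p`, `q` and a weight `c ∈ (0, 1/2]` the distances
`‖(c xₙ + (1 - c) p) - q‖` converge. The part `U` of the iteration from time `n` to time `m` is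
nonexpansive and fixes `p` and `q`. If `‖xₙ - p‖` has almost reached its limit, `U` nearly
preserves the distance of `xₙ` and `p`, and uniform convexity forces `U` to be nearly affine on
the segment `[p, xₙ]`. -/
theorem MannStepsContractOn.cauchySeq_norm_combination [UniformConvexSpace E]
    (h : MannStepsContractOn T C l s) (hl : 0 < l) (hC : Convex ℝ C) (hTC : Set.MapsTo T C C)
    (hs1 : s ≤ 1) {t : ℕ → ℝ} (ht : ∀ n, t n ∈ Set.Ioo 0 s)
    {x p q : E} (hx : x ∈ C) (hp : p ∈ C) (hpT : T p = p) (hq : q ∈ C) (hqT : T q = q)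
    {c : ℝ} (hc0 : 0 < c) (hc : c ≤ 1 / 2) :
    CauchySeq fun n => ‖(p - q) + c • (mannIteration T t x n - p)‖ := by
  have ht' : ∀ n, t n ∈ Set.Icc (0 : ℝ) 1 := fun n => ⟨(ht n).1.le, (ht n).2.le.trans hs1⟩
  have hmem := mannIteration_mem hC hTC ht' hx
  have hanti := h.antitone_norm_sub hl.le hC hTC hs1 ht hx hp hpT
  have hadd := mannIteration_add T t x
  have hzero : mannIteration T t x 0 = x := rfl
  set y := mannIteration T t x
  refine cauchySeq_of_eventually_le_add (fun n => norm_nonneg _) fun ε hε => ?_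
  obtain ⟨δ, hδ, huc⟩ := exists_forall_closedBall_norm_sub_lt_of_weight (E := E) hε ‖x - p‖ hc0 hc
  have hcau : CauchySeq fun n => ‖y n - p‖ :=
    (tendsto_atTop_ciInf hanti ⟨0, by rintro _ ⟨n, rfl⟩; exact norm_nonneg _⟩).cauchySeq
  obtain ⟨N, hN⟩ := Metric.cauchySeq_iff.1 hcau δ hδ
  refine ⟨N, fun n hn m hm => ?_⟩
  obtain ⟨j, rfl⟩ := Nat.exists_eq_add_of_le hm
  have htn : ∀ i, t (n + i) ∈ Set.Ioo 0 s := fun i => ht (n + i)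
  set z := c • y n + (1 - c) • p with hz
  have hzC : z ∈ C := hC (hmem n) hp hc0.le (by linarith) (by ring)
  set w := mannIteration T (fun i => t (n + i)) z j with hw
  have hU := fun {u v : E} (hu : u ∈ C) (hv : v ∈ C) =>
    h.norm_mannIteration_sub_le hl.le hC hTC hs1 htn hu hv j
  have h1 : ‖w - p‖ ≤ c * ‖y n - p‖ := by
    have := hU hzC hp
    rw [mannIteration_of_fixed hpT] at this
    refine this.trans_eq ?_
    have e : z - p = c • (y n - p) := by rw [hz]; module
    rw [e, norm_smul, Real.norm_of_nonneg hc0.le]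
  have h2 : ‖y (n + j) - w‖ ≤ (1 - c) * ‖y n - p‖ := by
    have := hU (hmem n) hzC
    rw [← hadd] at this
    refine this.trans_eq ?_
    have e : y n - z = (1 - c) • (y n - p) := by rw [hz]; module
    rw [e, norm_smul, Real.norm_of_nonneg (by linarith)]
  have h3 : ‖w - q‖ ≤ ‖z - q‖ := by
    have := hU hzC hq
    rwa [mannIteration_of_fixed hqT] at this
  have h4 : ‖y n - p‖ - δ < ‖y (n + j) - p‖ := by
    have := hN n hn (n + j) (by omega)
    rw [Real.dist_eq, abs_lt] at this
    linarith [this.2]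
  have hc1 : 0 < 1 - c := by linarith
  -- `y (n + j) - p = c a + (1 - c) b` with both `a` and `b` in the ball of radius `‖y n - p‖`
  set a := c⁻¹ • (w - p) with ha
  set b := (1 - c)⁻¹ • (y (n + j) - w) with hb
  have hca : c • a = w - p := smul_inv_smul₀ hc0.ne' _
  have hcb : (1 - c) • b = y (n + j) - w := smul_inv_smul₀ hc1.ne' _
  have hab : ‖a - b‖ < ε := by
    refine huc ‖y n - p‖ (hanti (Nat.zero_le n)) a b ?_ ?_ ?_
    · rw [ha, norm_smul, norm_inv, Real.norm_of_nonneg hc0.le, inv_mul_le_iff₀ hc0]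
      exact h1
    · rw [hb, norm_smul, norm_inv, Real.norm_of_nonneg hc1.le, inv_mul_le_iff₀ hc1]
      exact h2
    · rw [hca, hcb, add_comm, sub_add_sub_cancel]
      exact h4
  have e1 : (p - q) + c • (y (n + j) - p) = (w - q) + (-(c * (1 - c))) • (a - b) := by
    have e2 : y (n + j) - p = c • a + (1 - c) • b := by
      rw [hca, hcb]; abel
    have e3 : w = c • a + p := by rw [hca]; abel
    rw [e2, e3]
    module
  have e4 : (p - q) + c • (y n - p) = z - q := by rw [hz]; module
  rw [e1, e4]
  refine (norm_add_le _ _).trans (add_le_add h3 ?_)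
  rw [norm_smul, norm_neg, Real.norm_of_nonneg (by positivity)]
  have h5 : c * (1 - c) ≤ 1 := by nlinarith
  calc c * (1 - c) * ‖a - b‖ ≤ 1 * ‖a - b‖ := by gcongr
    _ ≤ ε := by linarith

/-- For fixed points `p`, `q` the pairings `j(p - q)(xₙ - p)` converge: by the two-sided quadratic
estimate they are uniformly approximated, up to `O(c)`, by the convergent sequences
`(‖(p - q) + c (xₙ - p)‖² - ‖p - q‖²) / (2 c)`. -/
theorem MannStepsContractOn.cauchySeq_dualityMap [UniformConvexSpace E]
    (h : MannStepsContractOn T C l s) (hl : 0 < l) (hC : Convex ℝ C) (hTC : Set.MapsTo T C C)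
    (hs1 : s ≤ 1) {t : ℕ → ℝ} (ht : ∀ n, t n ∈ Set.Ioo 0 s) {d : ℝ} (hd : 0 < d)
    (hsm : ∀ x w : E, ‖x + w‖ ^ 2 ≤ ‖x‖ ^ 2 + 2 * dualityMap x w + d * ‖w‖ ^ 2)
    {x p q : E} (hx : x ∈ C) (hp : p ∈ C) (hpT : T p = p) (hq : q ∈ C) (hqT : T q = q) :
    CauchySeq fun n => dualityMap (p - q) (mannIteration T t x n - p) := by
  have hanti := h.antitone_norm_sub hl.le hC hTC hs1 ht hx hp hpT
  have hcomb := fun (c : ℝ) (hc0 : 0 < c) (hc : c ≤ 1 / 2) =>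
    h.cauchySeq_norm_combination hl hC hTC hs1 ht hx hp hpT hq hqT hc0 hc
  set y := mannIteration T t x
  set R := ‖y 0 - p‖
  have hyR : ∀ n, ‖y n - p‖ ≤ R := fun n => hanti (Nat.zero_le n)
  refine Metric.cauchySeq_iff'.2 fun ε hε => ?_
  -- the weight is so small that the error `c d R² / 2` of the approximation is below `ε / 4`
  set c := min (1 / 2) (ε / (2 * (d * R ^ 2 + 1))) with hc
  have hc0 : 0 < c := by positivity
  have hcε : c * (d * R ^ 2) < ε / 2 := by
    have h1 : c * (2 * (d * R ^ 2 + 1)) ≤ ε := by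
      rw [← le_div_iff₀ (by positivity)]; exact min_le_right _ _
    linarith
  have hsq : CauchySeq fun n => ‖(p - q) + c • (y n - p)‖ ^ 2 := by
    obtain ⟨L, hL⟩ := cauchySeq_tendsto_of_complete (hcomb c hc0 (min_le_left _ _))
    exact (hL.pow 2).cauchySeq
  obtain ⟨N, hN⟩ := Metric.cauchySeq_iff'.1 hsq (c * ε) (by positivity)
  refine ⟨N, fun n hn => ?_⟩
  have hup : ∀ n, ‖(p - q) + c • (y n - p)‖ ^ 2 ≤
      ‖p - q‖ ^ 2 + 2 * (c * dualityMap (p - q) (y n - p)) + c * (c * (d * R ^ 2)) := by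
    intro n
    refine (hsm _ _).trans ?_
    rw [map_smul, smul_eq_mul, norm_smul, Real.norm_of_nonneg hc0.le]
    have h1 : d * (c * ‖y n - p‖) ^ 2 ≤ d * (c * R) ^ 2 := by gcongr; exact hyR n
    linarith
  have hlo : ∀ n, ‖p - q‖ ^ 2 + 2 * (c * dualityMap (p - q) (y n - p)) ≤
      ‖(p - q) + c • (y n - p)‖ ^ 2 := by
    intro n
    have := norm_sq_add_two_mul_dualityMap_le (p - q) (c • (y n - p))
    rwa [map_smul, smul_eq_mul] at this
  have h1 := hN n hn
  rw [Real.dist_eq, abs_lt] at h1 ⊢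
  have h2 : c * (c * (d * R ^ 2)) < c * (ε / 2) := by gcongr
  constructor
  · refine lt_of_mul_lt_mul_left ?_ hc0.le
    linarith [hup n, hlo N]
  · refine lt_of_mul_lt_mul_left ?_ hc0.le
    linarith [hup N, hlo n]

end Pairings

/-! ### Weak convergence -/

section WeakConvergence

variable {E : Type*} [NormedAddCommGroup E] [NormedSpace ℝ E]

theorem apply_le_of_mem_closure_convexHull {f : StrongDual ℝ E} {S : Set E} {r : ℝ}
    (hS : ∀ z ∈ S, f z ≤ r) {z : E} (hz : z ∈ closure (convexHull ℝ S)) : f z ≤ r :=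
  closure_minimal (convexHull_min (t := {w | f w ≤ r}) hS
    (convex_halfSpace_le f.toLinearMap.isLinear r))
    (isClosed_le f.continuous continuous_const) hz

/-- A point in the closed convex hulls of all tails inherits the limit of a functional along the
sequence. -/
theorem apply_eq_of_forall_mem_closure_convexHull {f : StrongDual ℝ E} {y : ℕ → E} {L : ℝ}
    (hf : Tendsto (fun n => f (y n)) atTop (𝓝 L)) {z : E}
    (hz : ∀ n, z ∈ closure (convexHull ℝ (y '' Set.Ici n))) : f z = L := by
  refine le_antisymm (le_of_forall_pos_le_add fun ε hε => ?_)
    (le_of_forall_pos_le_add fun ε hε => ?_)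
  · obtain ⟨N, hN⟩ := eventually_atTop.1 (hf.eventually_lt_const (lt_add_of_pos_right L hε))
    refine apply_le_of_mem_closure_convexHull ?_ (hz N)
    rintro _ ⟨n, hn, rfl⟩
    exact (hN n hn).le
  · obtain ⟨N, hN⟩ := eventually_atTop.1 (hf.eventually_const_lt (sub_lt_self L hε))
    have : (-f) z ≤ -(L - ε) := by
      refine apply_le_of_mem_closure_convexHull ?_ (hz N)
      rintro _ ⟨n, hn, rfl⟩
      rw [neg_apply]
      exact neg_le_neg (hN n hn).le
    rw [neg_apply] at this
    linarith

/-- If `p` lies in all closed convex tail hulls of every subsequence of `y`, then `y` converges weakly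
to `p`: a subsequence with `f (y n)` away from `f p` would keep `p` out of its convex hull. -/
theorem tendsto_toWeakSpace_of_forall_subseq {y : ℕ → E} {p : E}
    (h : ∀ φ : ℕ → ℕ, StrictMono φ →
      ∀ n, p ∈ closure (convexHull ℝ ((y ∘ φ) '' Set.Ici n))) :
    Tendsto (fun n => toWeakSpace ℝ E (y n)) atTop (𝓝 (toWeakSpace ℝ E p)) := by
  -- a one-sided bound suffices, as it applies to `-f` as well
  have key : ∀ (f : StrongDual ℝ E), ∀ r > f p, ∀ᶠ n in atTop, f (y n) < r := by
    intro f r hr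
    by_contra hcon
    obtain ⟨φ, hφ, hφr⟩ := extraction_of_frequently_atTop (not_eventually.1 hcon)
    have : (-f) p ≤ -r := by
      refine apply_le_of_mem_closure_convexHull ?_ (h φ hφ 0)
      rintro _ ⟨n, -, rfl⟩
      simpa using hφr n
    rw [neg_apply] at this
    linarith
  have hinj : Function.Injective ((topDualPairing ℝ E).flip) := fun u v huv =>
    (SeparatingDual.eq_iff_forall_dual_eq (R := ℝ)).2 fun f => LinearMap.congr_fun huv f
  refine (WeakBilin.tendsto_iff_forall_eval_tendsto _ hinj).2 fun f => ?_
  change Tendsto (fun n => f (y n)) atTop (𝓝 (f p))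
  refine tendsto_order.2 ⟨fun r hr => ?_, fun r hr => key f r hr⟩
  filter_upwards [key (-f) (-r) (neg_lt_neg hr)] with n hn
  exact neg_lt_neg_iff.1 hn

end WeakConvergence

theorem theorem2 {E : Type*} [NormedAddCommGroup E] [NormedSpace ℝ E] [CompleteSpace E]
    [UniformConvexSpace E] (hE : IsUniformlySmooth E)
    (C : Set E) (hCconv : Convex ℝ C) (hCclosed : IsClosed C)
    (T : E → E) (hTC : Set.MapsTo T C C)
    (d : ℝ) (hd : 1 ≤ d) (hβ : ∀ (x : E) (t : ℝ), 0 < t → betaStar x t ≤ d * t)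
    (k : ℝ) (hk : k ∈ Set.Ioo (0 : ℝ) 1) (hT : IsStrictPseudocontractionOn k T C)
    (hFix : ∃ p ∈ C, T p = p)
    (x : E) (hx : x ∈ C)
    (t : ℕ → ℝ) (ht : ∀ n, t n ∈ Set.Ioo (0 : ℝ) ((1 - k) / (2 * d)))
    (htsum : Tendsto (fun N : ℕ => ∑ n ∈ Finset.range N, t n) atTop atTop) :
    ∃ p ∈ C, T p = p ∧
      Tendsto (fun n : ℕ => toWeakSpace ℝ E (mannIteration T t x n)) atTop
        (𝓝 (toWeakSpace ℝ E p)) := by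
  obtain ⟨p₀, hp₀, hp₀T⟩ := hFix
  have hk1 : 0 < 1 - k := sub_pos.2 hk.2
  have hd0 : 0 < d := by linarith
  have hl : 0 < (1 - k) / 2 := by positivity
  have hs : 0 < (1 - k) / (2 * d) := by positivity
  have hs1 : (1 - k) / (2 * d) ≤ 1 := by
    rw [div_le_one (by positivity)]
    linarith [hk.1]
  have hsm := norm_add_sq_le_of_betaStar_le hβ
  have h := mannStepsContractOn_of_strictPseudocontraction hd0 hsm hT
  have ht' : ∀ n, t n ∈ Set.Icc (0 : ℝ) 1 := fun n => ⟨(ht n).1.le, (ht n).2.le.trans hs1⟩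
  have hmem := mannIteration_mem hCconv hTC ht' hx
  have hanti := h.antitone_norm_sub hl.le hCconv hTC hs1 ht hx hp₀ hp₀T
  have hlim := h.tendsto_norm_displacement hl hCconv hTC hs hs1 ht htsum hx hp₀ hp₀T
  have hpair := fun {p q : E} (hp : p ∈ C) (hpT : T p = p) (hq : q ∈ C) (hqT : T q = q) =>
    h.cauchySeq_dualityMap hl hCconv hTC hs1 ht hd0 hsm hx hp hpT hq hqT
  set y := mannIteration T t x
  have hbdd : ∀ n, ‖y n‖ ≤ ‖y 0 - p₀‖ + ‖p₀‖ := fun n => by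
    have h1 := hanti (Nat.zero_le n)
    have h2 := norm_add_le (y n - p₀) p₀
    rw [sub_add_cancel] at h2
    dsimp only at h1
    linarith
  have hsub : ∀ φ : ℕ → ℕ, StrictMono φ → ∃ q ∈ C, T q = q ∧
      ∀ n, q ∈ closure (convexHull ℝ ((y ∘ φ) '' Set.Ici n)) := fun φ hφ =>
    h.exists_fixedPoint_mem_closure_convexHull hl hCconv hCclosed hs (y := y ∘ φ)
      (fun n => hmem _) (fun n => hbdd _) (hlim.comp hφ.tendsto_atTop)
  have htail : ∀ φ : ℕ → ℕ, StrictMono φ → ∀ n,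
      closure (convexHull ℝ ((y ∘ φ) '' Set.Ici n)) ⊆ closure (convexHull ℝ (y '' Set.Ici n)) := by
    intro φ hφ n
    refine closure_mono (convexHull_mono ?_)
    rintro _ ⟨j, hj, rfl⟩
    exact ⟨φ j, le_trans hj (hφ.id_le j), rfl⟩
  -- two fixed points in all tail hulls coincide, since `j(p - q)` is constant on the
  -- intersection of the tail hulls
  have huniq : ∀ p ∈ C, T p = p → (∀ n, p ∈ closure (convexHull ℝ (y '' Set.Ici n))) →
      ∀ q ∈ C, T q = q → (∀ n, q ∈ closure (convexHull ℝ (y '' Set.Ici n))) → p = q := by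
    intro p hp hpT hpK q hq hqT hqK
    obtain ⟨L, hL⟩ := cauchySeq_tendsto_of_complete (hpair hp hpT hq hqT)
    have hL' : Tendsto (fun n => dualityMap (p - q) (y n)) atTop
        (𝓝 (L + dualityMap (p - q) p)) := by
      simpa using hL.add_const (dualityMap (p - q) p)
    have e : dualityMap (p - q) (p - q) = 0 := by
      rw [map_sub, apply_eq_of_forall_mem_closure_convexHull hL' hpK,
        apply_eq_of_forall_mem_closure_convexHull hL' hqK, sub_self]
    rw [dualityMap_apply_self] at e
    exact sub_eq_zero.1 (norm_eq_zero.1 (pow_eq_zero_iff two_ne_zero |>.1 e))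
  obtain ⟨p, hp, hpT, hpK⟩ := hsub id strictMono_id
  refine ⟨p, hp, hpT, tendsto_toWeakSpace_of_forall_subseq fun φ hφ n => ?_⟩
  obtain ⟨q, hq, hqT, hqK⟩ := hsub φ hφ
  rw [huniq p hp hpT hpK q hq hqT fun m => htail φ hφ m (hqK m)]
  exact hqK n
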